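/- Let $\lambda\in(0,1)$. For an integrable real random variable $Y$ put $q_Y^+(u)=\inf\{x: P(Y\le x)>u\}$, $\mathrm{VaR}_u(Y)=-q_Y^+(u)$ for $u\in(0,1)$, $\mathrm{ES}_t(Y)=\frac1t\int_0^t \mathrm{VaR}_u(Y)\,du$ for $t\in(0,1]$, and $$\Pi_\lambda(Y)=\inf\{c\in[1,\lambda^{-1}] : \mathrm{ES}_{c\lambda}(Y)\le \mathrm{VaR}_\lambda(Y)\},\qquad \inf\emptyset=\infty .$$ For a random vector $X=(X_1,\dots,X_n)$ with integrable components, weights $\omega_i\ge 0$ and $g:\mathbb R\to\mathbb R$ define (with $0\cdot\infty=0$) - $\text{A-PELVE}_{\lambda,\omega}(X)=\sum_{i=1}^n\omega_i\,\Pi_\lambda(X_i)$, where $\sum_i\omega_i=1$; - $\text{WC-PELVE}_\lambda(X)=\inf\{c\in[1,\lambda^{-1}] : \mathrm{ES}_{c\lambda}(X_i)\le \mathrm{VaR}_\lambda(X_i)\text{ for all } i\}$; - $\text{Sys-PELVE}_{\lambda,g}(X)=\inf\{c\in[1,\lambda^{-1}] : \sum_{i=1}^n g(\mathrm{ES}_{c\lambda}(X_i))\le\sum_{i=1}^n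 g(\mathrm{VaR}_\lambda(X_i))\}$; - $\text{MSE-PELVE}_{\lambda,\omega}(X)$ as the smallest minimizer over $c\in[1,\lambda^{-1}]$ of $\sqrt{\sum_{i=1}^n\omega_i\big(\mathrm{ES}_{c\lambda}(X_i)-\mathrm{VaR}_\lambda(X_i)\big)^2}$. Let $\Sigma\in\mathbb R^{n\times n}$ be positive semidefinite, $\mu\in\mathbb R^n$, and let $X\sim E_n(\mu,\Sigma,\varphi)$ be elliptical, i.e. $E[e^{i t^\top X}]=e^{i t^\top\mu}\varphi(t^\top\Sigma t)$ for all $t\in\mathbb R^n$. Let $Z\sim E_1(0,1,\varphi)$ be its standard generator, i.e. $E[e^{itZ}]=\varphi(t^2)$ for all $t\in\mathbb R$, and assume that $Z$ is integrable. Write $\sigma_i=\sqrt{\Sigma_{ii}}$. Then: 1. $\Pi_\lambda(X_i)=\Pi_\lambda(Z)$ for every $i$ with $\sigma_i>0$. 2. $\text{A-PELVE}_{\lambda,\omega}(X)=\Pi_\lambda(Z)$ whenever $\omega_i\ge0$, $\sum_i\omega_i=1$ and $\sigma_i>0$ for all $i$ with $\omega_i>0$. If $\sigma_i>0$ for at least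 one $i$, then $\text{WC-PELVE}_\lambda(X)=\Pi_\lambda(Z)$, and $\text{Sys-PELVE}_{\lambda,g}(X)=\Pi_\lambda(Z)$ for every strictly increasing $g$, in particular for $g(x)=x$. 3. Let $\omega_i\ge0$ for all $i$, with $\omega_i\sigma_i>0$ for at least one $i$. If $E[-Z]\le \mathrm{VaR}_\lambda(Z)$, then $\text{MSE-PELVE}_{\lambda,\omega}(X)=\Pi_\lambda(Z)$; otherwise $\text{MSE-PELVE}_{\lambda,\omega}(X)=\lambda^{-1}$. 4. For $g(x)=\max\{0,x\}$ one has $\text{Sys-PELVE}_{\lambda,g}(X)\le\Pi_\lambda(Z)$. If moreover $E[-Z]\le \mathrm{VaR}_\lambda(Z)$ and, for some $\gamma\in[0,\lambda)$, the map $t\mapsto\mathrm{ES}_t(Z)$ is strictly decreasing on $(\gamma,1]$ (for instance on $(0,1]$), then $\text{Sys-PELVE}_{\lambda,g}(X)=\Pi_\lambda(Z)$ if and only if there is an $i$ with $\sigma_i>0$ and $\mu_i\le\sigma_i\,\mathrm{VaR}_\lambda(Z)$. -/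

import Mathlib

open MeasureTheory
open scoped Matrix

namespace Pelve

noncomputable section

variable {Ω : Type*} [MeasurableSpace Ω]

/-- The upper quantile function `q_X⁺(u) = inf {x : F_X(x) > u}` of a real random variable
(used for `u ∈ (0,1)`). -/
def upperQuantile (P : Measure Ω) (X : Ω → ℝ) (u : ℝ) : ℝ :=
  sInf {x : ℝ | u < P.real {w | X w ≤ x}}

/-- Value at Risk, `VaR_u(X) = - q_X⁺(u)`. -/
def VaR (P : Measure Ω) (u : ℝ) (X : Ω → ℝ) : ℝ :=
  -upperQuantile P X u

/-- Expected Shortfall, `ES_t(X) = (1/t) ∫₀ᵗ VaR_u(X) du`, for `t ∈ (0,1]`. -/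
def ES (P : Measure Ω) (t : ℝ) (X : Ω → ℝ) : ℝ :=
  t⁻¹ * ∫ u in (0 : ℝ)..t, VaR P u X

/-- The infimum in `[-∞,∞]` of a set of real numbers, with `inf ∅ = ∞`. -/
def extInf (A : Set ℝ) : EReal :=
  sInf ((fun c : ℝ => (c : EReal)) '' A)

/-- The PELVE, `Π_λ(X) = inf {c ∈ [1, 1/λ] : ES_{cλ}(X) ≤ VaR_λ(X)}`. -/
def pelve (P : Measure Ω) (lam : ℝ) (X : Ω → ℝ) : EReal :=
  extInf {c : ℝ | c ∈ Set.Icc 1 lam⁻¹ ∧ ES P (c * lam) X ≤ VaR P lam X}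

variable {n : ℕ}

/-- The `i`-th component of a random vector. -/
def comp (X : Ω → EuclideanSpace ℝ (Fin n)) (i : Fin n) : Ω → ℝ :=
  fun w => X w i

/-- The average PELVE, `∑ᵢ ωᵢ Π_λ(Xᵢ)` (with `0 · ∞ = 0`). -/
def aPelve (P : Measure Ω) (lam : ℝ) (ω : Fin n → ℝ)
    (X : Ω → EuclideanSpace ℝ (Fin n)) : EReal :=
  ∑ i, (ω i : EReal) * pelve P lam (comp X i)

/-- The worst-case PELVE: the smallest `c ∈ [1, 1/λ]` that is admissible for all components. -/
def wcPelve (P : Measure Ω) (lam : ℝ) (X : Ω → EuclideanSpace ℝ (Fin n)) : EReal :=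
  extInf {c : ℝ | c ∈ Set.Icc 1 lam⁻¹ ∧
    ∀ i, ES P (c * lam) (comp X i) ≤ VaR P lam (comp X i)}

/-- The systemic PELVE with aggregation function `g`. -/
def sysPelve (P : Measure Ω) (lam : ℝ) (g : ℝ → ℝ)
    (X : Ω → EuclideanSpace ℝ (Fin n)) : EReal :=
  extInf {c : ℝ | c ∈ Set.Icc 1 lam⁻¹ ∧
    ∑ i, g (ES P (c * lam) (comp X i)) ≤ ∑ i, g (VaR P lam (comp X i))}

/-- The objective function of the MSE-PELVE. -/
def mseObjective (P : Measure Ω) (lam : ℝ) (ω : Fin n → ℝ)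
    (X : Ω → EuclideanSpace ℝ (Fin n)) (c : ℝ) : ℝ :=
  Real.sqrt (∑ i, ω i * (ES P (c * lam) (comp X i) - VaR P lam (comp X i)) ^ 2)

/-- The MSE-PELVE: the smallest minimizer of the objective over `[1, 1/λ]`. -/
def msePelve (P : Measure Ω) (lam : ℝ) (ω : Fin n → ℝ)
    (X : Ω → EuclideanSpace ℝ (Fin n)) : ℝ :=
  sInf {c : ℝ | c ∈ Set.Icc 1 lam⁻¹ ∧ IsMinOn (mseObjective P lam ω X) (Set.Icc 1 lam⁻¹) c}

/-- `X ∼ E_n(m, S, φ)`: the random vector `X` is elliptically distributed with location `m`,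
positive semidefinite dispersion matrix `S` and characteristic generator `φ`, i.e.
`E[exp(i tᵀX)] = exp(i tᵀm) φ(tᵀ S t)` for all `t`. -/
structure IsElliptical (P : Measure Ω) (X : Ω → EuclideanSpace ℝ (Fin n))
    (m : EuclideanSpace ℝ (Fin n)) (S : Matrix (Fin n) (Fin n) ℝ) (φ : ℝ → ℝ) : Prop where
  aemeasurable : AEMeasurable X P
  posSemidef : S.PosSemidef
  charFun_eq : ∀ t : EuclideanSpace ℝ (Fin n),
    charFun (P.map X) t =
      Complex.exp ((inner ℝ t m : ℝ) * Complex.I) * (φ (t.ofLp ⬝ᵥ (S *ᵥ t.ofLp)) : ℂ)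

/-- `Z ∼ E_1(0, 1, φ)`, for a real random variable `Z`: `E[exp(i t Z)] = φ(t²)` for all `t`. -/
structure IsStandardGenerator (P : Measure Ω) (Z : Ω → ℝ) (φ : ℝ → ℝ) : Prop where
  aemeasurable : AEMeasurable Z P
  charFun_eq : ∀ t : ℝ, charFun (P.map Z) t = (φ (t ^ 2) : ℂ)

end

end Pelve

/-! Each margin `X i` has the law of `m i + σ i * Z` with `σ i = √(S i i)`, so its VaR and ES are
those of `Z` scaled by `σ i` and shifted by `-m i`. Only `e c = ES_{cλ}(Z)` and the level `v =
VaR_λ(Z)` matter: locations cancel, positive scales divide out, and the MSE objective is a positive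
constant times `|e c - v|` (`isMinOn_mseObjective_iff`).

The function `e` is continuous and nonincreasing, with `v ≤ e 1` and `e λ⁻¹ = E[-Z]`. If `E[-Z] ≤
v`, there is a first crossing with equality (`exists_isLeast_crossing`); otherwise `e > v`
throughout, and `λ⁻¹` is the only minimizer (`ES_one_le_VaR`).

For `max 0`, a nondegenerate component with nonnegative VaR still detects `e c > v`. Without one,
all nondegenerate terms vanish slightly before the crossing (`sysPelve_max_lt`). -/

namespace Pelve

open Set Filter Topology ProbabilityTheory

/-! ### Quantiles and their law -/

section Quantile

variable {Ω : Type*} [MeasurableSpace Ω] {P : Measure Ω} [IsProbabilityMeasure P]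
  {X : Ω → ℝ} {u x : ℝ}

theorem real_le_eq_cdf (hX : AEMeasurable X P) (x : ℝ) :
    P.real {w | X w ≤ x} = cdf (P.map X) x := by
  have := Measure.isProbabilityMeasure_map hX
  rw [cdf_eq_real, map_measureReal_apply_of_aemeasurable hX measurableSet_Iic]
  rfl

theorem upperQuantile_eq (hX : AEMeasurable X P) (u : ℝ) :
    upperQuantile P X u = sInf {x | u < cdf (P.map X) x} := by
  simp only [upperQuantile, real_le_eq_cdf hX]

theorem nonempty_lt_cdf (μ : Measure ℝ) (hu : u < 1) : {x | u < cdf μ x}.Nonempty :=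
  ((tendsto_cdf_atTop μ).eventually (lt_mem_nhds hu)).exists

theorem bddBelow_lt_cdf (μ : Measure ℝ) (hu : 0 < u) : BddBelow {x | u < cdf μ x} := by
  obtain ⟨b, hb⟩ := ((tendsto_cdf_atBot μ).eventually (gt_mem_nhds hu)).exists
  exact ⟨b, fun x hx => le_of_not_gt fun h =>
    absurd (monotone_cdf μ h.le) (not_le.2 (hb.trans hx))⟩

theorem upperQuantile_le (hX : AEMeasurable X P) (hu : 0 < u) (h : u < cdf (P.map X) x) :
    upperQuantile P X u ≤ x := by
  rw [upperQuantile_eq hX]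
  exact csInf_le (bddBelow_lt_cdf _ hu) h

theorem le_cdf_of_upperQuantile_le (hX : AEMeasurable X P) (hu : u < 1)
    (h : upperQuantile P X u ≤ x) : u ≤ cdf (P.map X) x := by
  rw [upperQuantile_eq hX] at h
  refine ge_of_tendsto (((cdf (P.map X)).right_continuous x).mono Ioi_subset_Ici_self) ?_
  filter_upwards [self_mem_nhdsWithin] with y hy
  obtain ⟨z, hz, hzy⟩ := exists_lt_of_csInf_lt (nonempty_lt_cdf _ hu) (h.trans_lt hy)
  exact (lt_of_lt_of_le hz (monotone_cdf _ hzy.le)).le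

theorem monotoneOn_upperQuantile (hX : AEMeasurable X P) :
    MonotoneOn (upperQuantile P X) (Ioo 0 1) := by
  intro u hu v hv huv
  rw [upperQuantile_eq hX, upperQuantile_eq hX]
  exact csInf_le_csInf (bddBelow_lt_cdf _ hu.1) (nonempty_lt_cdf _ hv.2)
    fun x hx => lt_of_le_of_lt huv hx

theorem aemeasurable_upperQuantile (hX : AEMeasurable X P) :
    AEMeasurable (upperQuantile P X) (volume.restrict (Ioo 0 1)) :=
  aemeasurable_restrict_of_monotoneOn measurableSet_Ioo (monotoneOn_upperQuantile hX)

/-- The upper quantile function, on `(0,1)` with Lebesgue measure, has the law of the random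
variable. -/
theorem map_upperQuantile (hX : AEMeasurable X P) :
    (volume.restrict (Ioo (0 : ℝ) 1)).map (upperQuantile P X) = P.map X := by
  have := Measure.isProbabilityMeasure_map hX
  have hq := aemeasurable_upperQuantile hX
  symm
  refine Measure.ext_of_Iic _ _ fun x => ?_
  rw [Measure.map_apply_of_aemeasurable hq measurableSet_Iic, Measure.restrict_apply' measurableSet_Ioo,
    ← ofReal_cdf]
  have h0 := cdf_nonneg (P.map X) x
  have h1 := cdf_le_one (P.map X) x
  -- The set where the quantile is at most `x` lies between `(0, F x)` and `(0, F x]`, both of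
  -- length `F x`.
  apply le_antisymm
  · have hv : ENNReal.ofReal (cdf (P.map X) x) = volume (Ioo 0 (cdf (P.map X) x)) := by simp
    rw [hv]
    refine measure_mono fun u hu => ?_
    exact ⟨upperQuantile_le hX hu.1 hu.2, hu.1, hu.2.trans_le h1⟩
  · refine (measure_mono (t := Ioc 0 (cdf (P.map X) x)) fun u hu => ?_).trans_eq (by simp)
    exact ⟨hu.2.1, le_cdf_of_upperQuantile_le hX hu.2.2 hu.1⟩

theorem antitoneOn_VaR (hX : AEMeasurable X P) : AntitoneOn (fun u => VaR P u X) (Ioo 0 1) :=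
  fun _ hu _ hv huv => neg_le_neg (monotoneOn_upperQuantile hX hu hv huv)

theorem intervalIntegrable_VaR (hX : Integrable X P) :
    IntervalIntegrable (fun u => VaR P u X) volume 0 1 := by
  rw [intervalIntegrable_iff_integrableOn_Ioo_of_le zero_le_one]
  refine Integrable.neg ?_
  have hi : Integrable id (P.map X) :=
    (integrable_map_measure (by fun_prop) hX.aemeasurable).2 hX
  rw [← map_upperQuantile hX.aemeasurable] at hi
  exact (integrable_map_measure (by fun_prop) (aemeasurable_upperQuantile hX.aemeasurable)).1 hi

theorem ES_one (hX : AEMeasurable X P) : ES P 1 X = ∫ w, -X w ∂P := by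
  have hq := aemeasurable_upperQuantile hX
  rw [ES, inv_one, one_mul, intervalIntegral.integral_of_le zero_le_one,
    integral_Ioc_eq_integral_Ioo]
  calc _ = ∫ x, -x ∂((volume.restrict (Ioo (0 : ℝ) 1)).map (upperQuantile P X)) :=
        (integral_map hq (by fun_prop)).symm
    _ = _ := by rw [map_upperQuantile hX, integral_map hX (by fun_prop)]

end Quantile

/-! ### VaR and ES under location-scale maps -/

section Affine

variable {Ω Ω' : Type*} [MeasurableSpace Ω] [MeasurableSpace Ω']
  {P : Measure Ω} [IsProbabilityMeasure P] {P' : Measure Ω'} [IsProbabilityMeasure P']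
  {X : Ω → ℝ} {Z : Ω' → ℝ} {a s u t : ℝ}

theorem upperQuantile_affine (hX : AEMeasurable X P) (hZ : AEMeasurable Z P')
    (h : P.map X = P'.map fun w => a + s * Z w) (hs : 0 ≤ s) (hu : u ∈ Ioo (0 : ℝ) 1) :
    upperQuantile P X u = a + s * upperQuantile P' Z u := by
  have hY : AEMeasurable (fun w => a + s * Z w) P' := by fun_prop
  have hXY : upperQuantile P X u = upperQuantile P' (fun w => a + s * Z w) u := by
    rw [upperQuantile_eq hX, upperQuantile_eq hY, h]
  rw [hXY]
  -- Degenerate margins are constants; the affine map is then not invertible, so the case is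
  -- separate.
  rcases hs.eq_or_lt with rfl | hs
  · have : {x : ℝ | u < P'.real {_w | a ≤ x}} = Ici a := by
      ext x
      by_cases hx : a ≤ x
      · simp [hx, hu.2]
      · simp [hx, hu.1.le]
    simp [upperQuantile, this]
  · have hg := isGLB_csInf (nonempty_lt_cdf (P'.map Z) hu.2) (bddBelow_lt_cdf _ hu.1)
    rw [← upperQuantile_eq hZ] at hg
    have hset : {x : ℝ | u < P'.real {w | a + s * Z w ≤ x}} =
        (fun x => a + s * x) '' {x | u < cdf (P'.map Z) x} := by
      ext x
      have e : {w | a + s * Z w ≤ x} = {w | Z w ≤ (x - a) / s} := by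
        ext w
        simp only [mem_ofPred_eq]
        rw [le_div_iff₀ hs]
        constructor <;> intro <;> linarith
      simp only [mem_ofPred_eq, mem_image, e, real_le_eq_cdf hZ]
      constructor
      · exact fun hx => ⟨_, hx, by field_simp; ring⟩
      · rintro ⟨y, hy, rfl⟩
        have : (a + s * y - a) / s = y := by field_simp; ring
        rwa [this]
    rw [upperQuantile, hset]
    refine IsGLB.csInf_eq ⟨?_, ?_⟩ ((nonempty_lt_cdf _ hu.2).image _)
    · rintro _ ⟨y, hy, rfl⟩
      have := hg.1 hy
      dsimp only
      gcongr
    · intro b hb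
      have : (b - a) / s ≤ upperQuantile P' Z u := hg.2 fun y hy => by
        have := hb ⟨y, hy, rfl⟩
        rw [div_le_iff₀ hs]
        dsimp only at this
        linarith
      rw [div_le_iff₀ hs] at this
      linarith

theorem VaR_affine (hX : AEMeasurable X P) (hZ : AEMeasurable Z P')
    (h : P.map X = P'.map fun w => a + s * Z w) (hs : 0 ≤ s) (hu : u ∈ Ioo (0 : ℝ) 1) :
    VaR P u X = -a + s * VaR P' u Z := by
  rw [VaR, VaR, upperQuantile_affine hX hZ h hs hu]
  ring

theorem intervalIntegrable_VaR_of_mem (hZ : Integrable Z P') {t₁ t₂ : ℝ}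
    (h₁ : t₁ ∈ Icc (0 : ℝ) 1) (h₂ : t₂ ∈ Icc (0 : ℝ) 1) :
    IntervalIntegrable (fun u => VaR P' u Z) volume t₁ t₂ :=
  (intervalIntegrable_VaR hZ).mono_set
    (by rw [uIcc_of_le zero_le_one]; exact ordConnected_Icc.uIcc_subset h₁ h₂)

theorem ES_affine (hX : AEMeasurable X P) (hZ : Integrable Z P')
    (h : P.map X = P'.map fun w => a + s * Z w) (hs : 0 ≤ s) (ht : t ∈ Ioc (0 : ℝ) 1) :
    ES P t X = -a + s * ES P' t Z := by
  have hi : IntervalIntegrable (fun u => VaR P' u Z) volume 0 t :=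
    intervalIntegrable_VaR_of_mem hZ (by simp) ⟨ht.1.le, ht.2⟩
  have : ∫ u in (0 : ℝ)..t, VaR P u X = ∫ u in (0 : ℝ)..t, (-a + s * VaR P' u Z) := by
    -- The affine rule for VaR needs `u < 1`, so the endpoint is dropped to allow `t = 1`.
    rw [intervalIntegral.integral_of_le ht.1.le, intervalIntegral.integral_of_le ht.1.le,
      integral_Ioc_eq_integral_Ioo, integral_Ioc_eq_integral_Ioo]
    exact setIntegral_congr_fun measurableSet_Ioo fun u hu =>
      VaR_affine hX hZ.aemeasurable h hs ⟨hu.1, hu.2.trans_le ht.2⟩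
  rw [ES, ES, this, intervalIntegral.integral_add (by simp) (hi.const_mul s)]
  have := ht.1.ne'
  simp only [intervalIntegral.integral_const, intervalIntegral.integral_const_mul, smul_eq_mul]
  field_simp
  ring

end Affine

/-! ### Monotonicity of ES and its equality cases -/

section ExpectedShortfall

theorem mul_ES {Ω : Type*} [MeasurableSpace Ω] {P : Measure Ω} {Z : Ω → ℝ} {t : ℝ}
    (ht : t ≠ 0) : t * ES P t Z = ∫ u in (0 : ℝ)..t, VaR P u Z := by
  rw [ES, mul_inv_cancel_left₀ ht]

variable {Ω : Type*} [MeasurableSpace Ω] {P : Measure Ω} [IsProbabilityMeasure P]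
  {Z : Ω → ℝ} {s t : ℝ}

theorem mul_ES_add (hZ : Integrable Z P) (hs : 0 < s) (hst : s ≤ t) (ht : t ≤ 1) :
    t * ES P t Z = s * ES P s Z + ∫ u in s..t, VaR P u Z := by
  rw [mul_ES (hs.trans_le hst).ne', mul_ES hs.ne', intervalIntegral.integral_add_adjacent_intervals]
  · exact intervalIntegrable_VaR_of_mem hZ (by simp) ⟨hs.le, hst.trans ht⟩
  · exact intervalIntegrable_VaR_of_mem hZ ⟨hs.le, hst.trans ht⟩ ⟨hs.le.trans hst, ht⟩

theorem continuousOn_ES (hZ : Integrable Z P) : ContinuousOn (fun t => ES P t Z) (Ioc 0 1) := by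
  have h := intervalIntegral.continuousOn_primitive_interval' (intervalIntegrable_VaR hZ)
    (left_mem_uIcc)
  rw [uIcc_of_le zero_le_one] at h
  exact (continuousOn_inv₀.mono fun t ht => ht.1.ne').mul (h.mono Ioc_subset_Icc_self)

theorem integral_VaR_le (hZ : Integrable Z P) (hs : 0 < s) (hs1 : s < 1) (hst : s ≤ t)
    (ht : t ≤ 1) : ∫ u in s..t, VaR P u Z ≤ (t - s) * VaR P s Z := by
  have := intervalIntegral.integral_mono_on_of_le_Ioo hst (g := fun _ => VaR P s Z)
    (intervalIntegrable_VaR_of_mem hZ ⟨hs.le, hst.trans ht⟩ ⟨hs.le.trans hst, ht⟩) (by simp)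
    fun u hu => antitoneOn_VaR hZ.aemeasurable ⟨hs, hs1⟩
      ⟨hs.trans hu.1, hu.2.trans_le ht⟩ hu.1.le
  simpa using this

theorem le_integral_VaR (hZ : Integrable Z P) (hs : 0 ≤ s) (hst : s ≤ t)
    (h0 : 0 < t) (ht : t < 1) : (t - s) * VaR P t Z ≤ ∫ u in s..t, VaR P u Z := by
  have := intervalIntegral.integral_mono_on_of_le_Ioo hst (f := fun _ => VaR P t Z) (by simp)
    (intervalIntegrable_VaR_of_mem hZ ⟨hs, hst.trans ht.le⟩ ⟨hs.trans hst, ht.le⟩)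
    fun u hu => antitoneOn_VaR hZ.aemeasurable ⟨hs.trans_lt hu.1, hu.2.trans ht⟩
      ⟨h0, ht⟩ hu.2.le
  simpa using this

theorem VaR_le_ES (hZ : Integrable Z P) (h0 : 0 < t) (ht : t < 1) : VaR P t Z ≤ ES P t Z := by
  have := le_integral_VaR hZ le_rfl h0.le h0 ht
  rw [← mul_ES h0.ne', sub_zero] at this
  exact le_of_mul_le_mul_left this h0

/-- `ES_t` averages `ES_s` with the mean of VaR over `[s, t]`, which is at most `VaR_s ≤ ES_s`. -/
theorem antitoneOn_ES (hZ : Integrable Z P) : AntitoneOn (fun t => ES P t Z) (Ioc 0 1) := by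
  intro s hs t ht hst
  rcases hst.eq_or_lt with rfl | hlt
  · exact le_rfl
  have hs1 := hlt.trans_le ht.2
  have h1 := mul_ES_add hZ hs.1 hst ht.2
  have h2 := integral_VaR_le hZ hs.1 hs1 hst ht.2
  have h3 := mul_le_mul_of_nonneg_left (VaR_le_ES hZ hs.1 hs1) (sub_nonneg.2 hst)
  exact le_of_mul_le_mul_left (by linarith) ht.1

/-- Rules out a tie with the right endpoint: `ES_1 ≤ t ES_1 + (1 - t) VaR_t`. -/
theorem ES_one_le_VaR (hZ : Integrable Z P) (h0 : 0 < t) (ht : t < 1)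
    (h : ES P t Z ≤ ES P 1 Z) : ES P 1 Z ≤ VaR P t Z := by
  have h1 := mul_ES_add hZ h0 ht.le le_rfl
  have h2 := integral_VaR_le hZ h0 ht ht.le le_rfl
  have h3 := mul_le_mul_of_nonneg_left h h0.le
  exact le_of_mul_le_mul_left (a := 1 - t) (by linarith) (by linarith)

/-- On `[s, t]` VaR is at least `VaR_t ≥ ES_t`, leaving at most `s ES_t` for `s ES_s`. This excludes
a crossing at `c = 1` when ES is strictly decreasing near `λ`. -/
theorem ES_le_of_ES_le_VaR (hZ : Integrable Z P) (h0 : 0 < s) (hst : s ≤ t) (ht : t < 1)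
    (h : ES P t Z ≤ VaR P t Z) : ES P s Z ≤ ES P t Z := by
  have h1 := mul_ES_add hZ h0 hst ht.le
  have h2 := le_integral_VaR hZ h0.le hst (h0.trans_le hst) ht
  have h3 := mul_le_mul_of_nonneg_left h (sub_nonneg.2 hst)
  exact le_of_mul_le_mul_left (by linarith) h0

end ExpectedShortfall

/-! ### Margins of elliptical vectors -/

section Elliptical

variable {Ω Ω' : Type*} [MeasurableSpace Ω] [MeasurableSpace Ω']
  {P : Measure Ω} {P' : Measure Ω'} {n : ℕ}
  {m : EuclideanSpace ℝ (Fin n)} {S : Matrix (Fin n) (Fin n) ℝ} {φ : ℝ → ℝ}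
  {X : Ω → EuclideanSpace ℝ (Fin n)} {Z : Ω' → ℝ}

theorem IsElliptical.aemeasurable_comp (hX : IsElliptical P X m S φ) (i : Fin n) :
    AEMeasurable (comp X i) P :=
  (by fun_prop : Measurable fun x : EuclideanSpace ℝ (Fin n) => x i).comp_aemeasurable
    hX.aemeasurable

theorem IsElliptical.charFun_comp (hX : IsElliptical P X m S φ) (i : Fin n) (t : ℝ) :
    charFun (P.map (comp X i)) t =
      Complex.exp ((t * m i : ℝ) * Complex.I) * (φ (t ^ 2 * S i i) : ℂ) := by
  have h := hX.charFun_eq (EuclideanSpace.single i t)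
  have e1 : inner ℝ (EuclideanSpace.single i t) m = t * m i := by
    simp [EuclideanSpace.inner_single_left]
  have e2 : (EuclideanSpace.single i t).ofLp ⬝ᵥ (S *ᵥ (EuclideanSpace.single i t).ofLp)
      = t ^ 2 * S i i := by
    simp [Matrix.mulVec_single]
    ring
  rw [e1, e2] at h
  rw [← h, charFun_apply, charFun_apply, integral_map (hX.aemeasurable_comp i) (by fun_prop),
    integral_map hX.aemeasurable (by fun_prop)]
  congr with w
  simp [EuclideanSpace.inner_single_right, comp]

theorem IsElliptical.map_comp [IsProbabilityMeasure P] [IsProbabilityMeasure P']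
    (hX : IsElliptical P X m S φ) (hZ : IsStandardGenerator P' Z φ)
    (i : Fin n) : P.map (comp X i) = P'.map fun w => m i + Real.sqrt (S i i) * Z w := by
  have hZm := hZ.aemeasurable
  have := Measure.isProbabilityMeasure_map (hX.aemeasurable_comp i)
  have := Measure.isProbabilityMeasure_map
    (by fun_prop : AEMeasurable (fun w => m i + Real.sqrt (S i i) * Z w) P')
  refine Measure.ext_of_charFun (funext fun t => ?_)
  have e : P'.map (fun w => m i + Real.sqrt (S i i) * Z w) =
      (P'.map fun w => Real.sqrt (S i i) * Z w).map (m i + ·) := by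
    rw [AEMeasurable.map_map_of_aemeasurable (by fun_prop) (by fun_prop)]
    rfl
  rw [hX.charFun_comp, e, charFun_map_const_add, charFun_map_mul_comp hZm, hZ.charFun_eq,
    mul_pow, Real.sq_sqrt hX.posSemidef.diag_nonneg, mul_comm, mul_comm (t ^ 2)]
  simp

end Elliptical

/-! ### Extended infima and first crossings -/

section ExtInf

theorem extInf_eq_of_isLeast {A : Set ℝ} {c : ℝ} (h : IsLeast A c) : extInf A = c :=
  IsLeast.csInf_eq ⟨mem_image_of_mem _ h.1, by
    rintro _ ⟨d, hd, rfl⟩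
    exact EReal.coe_le_coe_iff.2 (h.2 hd)⟩

theorem extInf_anti {A B : Set ℝ} (h : A ⊆ B) : extInf B ≤ extInf A :=
  sInf_le_sInf (image_mono h)

/-- Since `p` may be infinite, distributivity relies on the nonnegative weights. -/
theorem sum_coe_mul_ereal {ι : Type*} (s : Finset ι) {ω : ι → ℝ} (hω : ∀ i, 0 ≤ ω i) (p : EReal) :
    ∑ i ∈ s, (ω i : EReal) * p = ((∑ i ∈ s, ω i : ℝ) : EReal) * p := by
  classical
  induction s using Finset.induction_on with
  | empty => simp
  | insert i s hi ih =>
    rw [Finset.sum_insert hi, Finset.sum_insert hi, ih, EReal.coe_add,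
      EReal.right_distrib_of_nonneg (by exact_mod_cast hω i)
        (by exact_mod_cast Finset.sum_nonneg fun i _ => hω i)]

/-- A continuous function starting above the level `v` and ending below it has a first crossing. -/
theorem exists_isLeast_crossing {e : ℝ → ℝ} {a b v : ℝ} (hab : a ≤ b)
    (he : ContinuousOn e (Icc a b)) (ha : v ≤ e a) (hb : e b ≤ v) :
    ∃ c, e c = v ∧ IsLeast {c | c ∈ Icc a b ∧ e c ≤ v} c := by
  have hcl : IsClosed (Icc a b ∩ e ⁻¹' Iic v) := he.preimage_isClosed_of_isClosed isClosed_Icc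
    isClosed_Iic
  have hcp : IsCompact (Icc a b ∩ e ⁻¹' Iic v) := isCompact_Icc.of_isClosed_subset hcl
    inter_subset_left
  obtain ⟨c, hc⟩ := hcp.exists_isLeast ⟨b, right_mem_Icc.2 hab, hb⟩
  refine ⟨c, ?_, hc⟩
  -- The level is attained at some `d ≤ c`; minimality of `c` forces `d = c`.
  obtain ⟨d, hd, hdv⟩ := intermediate_value_Icc' hc.1.1.1
    (he.mono (Icc_subset_Icc_right hc.1.1.2)) ⟨hc.1.2, ha⟩
  have : c ≤ d := hc.2 ⟨⟨hd.1, hd.2.trans hc.1.1.2⟩, hdv.le⟩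
  rwa [le_antisymm this hd.2]

end ExtInf

/-! ### Multivariate PELVEs in terms of `e` and `v` -/

section LocationScale

variable {Ω : Type*} [MeasurableSpace Ω] {P : Measure Ω} {n : ℕ}
  {X : Ω → EuclideanSpace ℝ (Fin n)} {lam v : ℝ} {m σ : Fin n → ℝ} {e : ℝ → ℝ}

theorem pelve_comp_eq
    (hE : ∀ c ∈ Icc 1 lam⁻¹, ∀ i, ES P (c * lam) (comp X i) = -m i + σ i * e c)
    (hV : ∀ i, VaR P lam (comp X i) = -m i + σ i * v) {i : Fin n} (hi : 0 < σ i) :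
    pelve P lam (comp X i) = extInf {c | c ∈ Icc 1 lam⁻¹ ∧ e c ≤ v} := by
  unfold pelve
  congr 1
  ext c
  refine and_congr_right fun hc => ?_
  rw [hE c hc, hV, add_le_add_iff_left, mul_le_mul_iff_right₀ hi]

theorem aPelve_eq {ω : Fin n → ℝ} (hω : ∀ i, 0 ≤ ω i) (hsum : ∑ i, ω i = 1) {p : EReal}
    (h : ∀ i, 0 < ω i → pelve P lam (comp X i) = p) : aPelve P lam ω X = p := by
  have : ∀ i, (ω i : EReal) * pelve P lam (comp X i) = ω i * p := fun i => by
    rcases (hω i).eq_or_lt with hi | hi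
    · simp [← hi]
    · rw [h i hi]
  rw [aPelve, Finset.sum_congr rfl fun i _ => this i, sum_coe_mul_ereal _ hω, hsum, EReal.coe_one,
    one_mul]

theorem wcPelve_eq (hσ : ∀ i, 0 ≤ σ i)
    (hE : ∀ c ∈ Icc 1 lam⁻¹, ∀ i, ES P (c * lam) (comp X i) = -m i + σ i * e c)
    (hV : ∀ i, VaR P lam (comp X i) = -m i + σ i * v) (hex : ∃ i, 0 < σ i) :
    wcPelve P lam X = extInf {c | c ∈ Icc 1 lam⁻¹ ∧ e c ≤ v} := by
  obtain ⟨j, hj⟩ := hex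
  unfold wcPelve
  congr 1
  ext c
  refine and_congr_right fun hc => ?_
  simp only [hE c hc, hV, add_le_add_iff_left]
  exact ⟨fun h => le_of_mul_le_mul_left (h j) hj, fun h i => mul_le_mul_of_nonneg_left h (hσ i)⟩

theorem sysPelve_eq_extInf {g : ℝ → ℝ}
    (hE : ∀ c ∈ Icc 1 lam⁻¹, ∀ i, ES P (c * lam) (comp X i) = -m i + σ i * e c)
    (hV : ∀ i, VaR P lam (comp X i) = -m i + σ i * v) :
    sysPelve P lam g X = extInf {c | c ∈ Icc 1 lam⁻¹ ∧
      ∑ i, g (-m i + σ i * e c) ≤ ∑ i, g (-m i + σ i * v)} := by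
  unfold sysPelve
  congr 1
  ext c
  refine and_congr_right fun hc => ?_
  simp only [hE c hc, hV]

theorem sum_comp_affine_mono (hσ : ∀ i, 0 ≤ σ i) {g : ℝ → ℝ} (hg : Monotone g) {x y : ℝ}
    (h : x ≤ y) : ∑ i, g (-m i + σ i * x) ≤ ∑ i, g (-m i + σ i * y) :=
  Finset.sum_le_sum fun i _ => hg (by have := mul_le_mul_of_nonneg_left h (hσ i); linarith)

theorem sysPelve_le (hσ : ∀ i, 0 ≤ σ i)
    (hE : ∀ c ∈ Icc 1 lam⁻¹, ∀ i, ES P (c * lam) (comp X i) = -m i + σ i * e c)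
    (hV : ∀ i, VaR P lam (comp X i) = -m i + σ i * v) {g : ℝ → ℝ} (hg : Monotone g) :
    sysPelve P lam g X ≤ extInf {c | c ∈ Icc 1 lam⁻¹ ∧ e c ≤ v} := by
  rw [sysPelve_eq_extInf hE hV]
  exact extInf_anti fun c hc => ⟨hc.1, sum_comp_affine_mono hσ hg hc.2⟩

/-- One term that strictly increases above `v` suffices, which covers both strictly increasing `g`
and `max 0`. -/
theorem sysPelve_eq (hσ : ∀ i, 0 ≤ σ i)
    (hE : ∀ c ∈ Icc 1 lam⁻¹, ∀ i, ES P (c * lam) (comp X i) = -m i + σ i * e c)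
    (hV : ∀ i, VaR P lam (comp X i) = -m i + σ i * v) {g : ℝ → ℝ} (hg : Monotone g)
    (hlt : ∀ y, v < y → ∃ i, g (-m i + σ i * v) < g (-m i + σ i * y)) :
    sysPelve P lam g X = extInf {c | c ∈ Icc 1 lam⁻¹ ∧ e c ≤ v} := by
  rw [sysPelve_eq_extInf hE hV]
  congr 1
  ext c
  refine and_congr_right fun hc => ⟨fun h => ?_, sum_comp_affine_mono hσ hg⟩
  by_contra! hcv
  obtain ⟨j, hj⟩ := hlt _ hcv
  refine h.not_gt (Finset.sum_lt_sum (fun i _ => hg ?_) ⟨j, Finset.mem_univ j, hj⟩)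
  have := mul_le_mul_of_nonneg_left hcv.le (hσ i)
  linarith

/-- If all nondegenerate components have negative Value at Risk, then the systemic PELVE for
`max 0` lies strictly below the first crossing. -/
theorem sysPelve_max_lt (hσ : ∀ i, 0 ≤ σ i)
    (hE : ∀ c ∈ Icc 1 lam⁻¹, ∀ i, ES P (c * lam) (comp X i) = -m i + σ i * e c)
    (hV : ∀ i, VaR P lam (comp X i) = -m i + σ i * v) (he : ContinuousOn e (Icc 1 lam⁻¹))
    {c : ℝ} (h1 : 1 < c) (h2 : c ≤ lam⁻¹) (hc : e c = v)
    (hneg : ∀ i, 0 < σ i → σ i * v < m i) : sysPelve P lam (fun x => max 0 x) X < c := by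
  have hcont : Tendsto e (𝓝[<] c) (𝓝 v) := by
    rw [← hc]
    refine ((he c ⟨h1.le, h2⟩).mono_of_mem_nhdsWithin ?_ : ContinuousWithinAt e (Iio c) c)
    filter_upwards [Ico_mem_nhdsLT h1] with x hx using ⟨hx.1, hx.2.le.trans h2⟩
  have hev : ∀ i, ∀ᶠ x in 𝓝[<] c, 0 < σ i → σ i * e x < m i := fun i => by
    by_cases hi : 0 < σ i
    · filter_upwards [(hcont.const_mul (σ i)).eventually (gt_mem_nhds (hneg i hi))] with x hx _
        using hx
    · exact Eventually.of_forall fun _ h => absurd h hi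
  obtain ⟨d, hd, hd1, hdc⟩ := ((eventually_all.2 hev).and (Ico_mem_nhdsLT h1)).exists
  refine lt_of_le_of_lt ?_ (EReal.coe_lt_coe_iff.2 hdc)
  rw [sysPelve_eq_extInf hE hV]
  refine sInf_le ⟨d, ⟨⟨hd1, hdc.le.trans h2⟩, Finset.sum_le_sum fun i _ => ?_⟩, rfl⟩
  rcases (hσ i).eq_or_lt with hi | hi
  · simp [← hi]
  · have := hd i hi
    exact (max_eq_left (by linarith)).trans_le (le_max_left _ _)

theorem mseObjective_eq {ω : Fin n → ℝ}
    (hE : ∀ c ∈ Icc 1 lam⁻¹, ∀ i, ES P (c * lam) (comp X i) = -m i + σ i * e c)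
    (hV : ∀ i, VaR P lam (comp X i) = -m i + σ i * v) {c : ℝ} (hc : c ∈ Icc 1 lam⁻¹) :
    mseObjective P lam ω X c = Real.sqrt (∑ i, ω i * σ i ^ 2) * |e c - v| := by
  rw [mseObjective, ← Real.sqrt_sq_eq_abs, ← Real.sqrt_mul' _ (sq_nonneg _), Finset.sum_mul]
  congr 1
  refine Finset.sum_congr rfl fun i _ => ?_
  rw [hE c hc, hV]
  ring

theorem isMinOn_mseObjective_iff {ω : Fin n → ℝ} (hω : ∀ i, 0 ≤ ω i)
    (hpos : ∃ i, 0 < ω i ∧ 0 < σ i)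
    (hE : ∀ c ∈ Icc 1 lam⁻¹, ∀ i, ES P (c * lam) (comp X i) = -m i + σ i * e c)
    (hV : ∀ i, VaR P lam (comp X i) = -m i + σ i * v) :
    ∀ c ∈ Icc 1 lam⁻¹, (IsMinOn (mseObjective P lam ω X) (Icc 1 lam⁻¹) c ↔
      ∀ d ∈ Icc 1 lam⁻¹, |e c - v| ≤ |e d - v|) := by
  intro c hc
  obtain ⟨j, hj, hj'⟩ := hpos
  have hK : 0 < Real.sqrt (∑ i, ω i * σ i ^ 2) := Real.sqrt_pos.2 <|
    Finset.sum_pos' (fun i _ => mul_nonneg (hω i) (sq_nonneg _))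
      ⟨j, Finset.mem_univ j, by positivity⟩
  rw [isMinOn_iff]
  refine forall₂_congr fun d hd => ?_
  rw [mseObjective_eq hE hV hc, mseObjective_eq hE hV hd, mul_le_mul_iff_right₀ hK]

end LocationScale

end Pelve

/-! ### The main theorem -/

open Pelve in
theorem mainTheorem5 {Ω Ω' : Type*} [MeasurableSpace Ω] [MeasurableSpace Ω']
    (P : Measure Ω) [IsProbabilityMeasure P] (P' : Measure Ω') [IsProbabilityMeasure P']
    (n : ℕ) (m : EuclideanSpace ℝ (Fin n)) (S : Matrix (Fin n) (Fin n) ℝ) (φ : ℝ → ℝ)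
    (X : Ω → EuclideanSpace ℝ (Fin n)) (hX : IsElliptical P X m S φ)
    (Z : Ω' → ℝ) (hZ : IsStandardGenerator P' Z φ) (hZint : Integrable Z P')
    (lam : ℝ) (hlam : lam ∈ Set.Ioo (0 : ℝ) 1) :
    -- marginal PELVEs
    (∀ i, 0 < S i i → pelve P lam (comp X i) = pelve P' lam Z) ∧
    -- A-PELVE
    (∀ ω : Fin n → ℝ, (∀ i, 0 ≤ ω i) → ∑ i, ω i = 1 → (∀ i, 0 < ω i → 0 < S i i) →
      aPelve P lam ω X = pelve P' lam Z) ∧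
    -- WC-PELVE
    ((∃ i, 0 < S i i) → wcPelve P lam X = pelve P' lam Z) ∧
    -- Sys-PELVE, for strictly increasing `g`, in particular `g(x) = x`
    ((∃ i, 0 < S i i) → ∀ g : ℝ → ℝ, StrictMono g →
      sysPelve P lam g X = pelve P' lam Z) ∧
    -- MSE-PELVE
    (∀ ω : Fin n → ℝ, (∀ i, 0 ≤ ω i) → (∃ i, 0 < ω i ∧ 0 < S i i) →
      (∫ w, -Z w ∂P' ≤ VaR P' lam Z → (msePelve P lam ω X : EReal) = pelve P' lam Z) ∧
      (VaR P' lam Z < ∫ w, -Z w ∂P' → msePelve P lam ω X = lam⁻¹)) ∧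
    -- Sys-PELVE for `g(x) = max {0, x}`
    sysPelve P lam (fun x => max 0 x) X ≤ pelve P' lam Z ∧
    (∫ w, -Z w ∂P' ≤ VaR P' lam Z →
      (∃ γ ∈ Set.Ico 0 lam, StrictAntiOn (fun t => ES P' t Z) (Set.Ioc γ 1)) →
      (sysPelve P lam (fun x => max 0 x) X = pelve P' lam Z ↔
        ∃ i, 0 < S i i ∧ m i ≤ Real.sqrt (S i i) * VaR P' lam Z)) := by
  obtain ⟨h0, h1⟩ := id hlam
  have hmem : ∀ c ∈ Set.Icc 1 lam⁻¹, c * lam ∈ Set.Ioc 0 1 := fun c hc =>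
    ⟨mul_pos (one_pos.trans_le hc.1) h0,
      (mul_le_mul_of_nonneg_right hc.2 h0.le).trans_eq (inv_mul_cancel₀ h0.ne')⟩
  have hσ : ∀ i, 0 ≤ Real.sqrt (S i i) := fun i => Real.sqrt_nonneg _
  have hE : ∀ c ∈ Set.Icc 1 lam⁻¹, ∀ i, ES P (c * lam) (comp X i) =
      -m i + Real.sqrt (S i i) * ES P' (c * lam) Z := fun c hc i =>
    ES_affine (hX.aemeasurable_comp i) hZint (hX.map_comp hZ i) (hσ i) (hmem c hc)
  have hV : ∀ i, VaR P lam (comp X i) = -m i + Real.sqrt (S i i) * VaR P' lam Z := fun i =>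
    VaR_affine (hX.aemeasurable_comp i) hZint.aemeasurable (hX.map_comp hZ i) (hσ i) hlam
  have hcont : ContinuousOn (fun c => ES P' (c * lam) Z) (Set.Icc 1 lam⁻¹) :=
    (continuousOn_ES hZint).comp (by fun_prop) hmem
  have hle : 1 ≤ lam⁻¹ := (one_le_inv₀ h0).2 h1.le
  have hmono : Monotone fun x : ℝ => max 0 x := fun x y h => max_le_max le_rfl h
  have hcross : ∫ w, -Z w ∂P' ≤ VaR P' lam Z → ∃ c, ES P' (c * lam) Z = VaR P' lam Z ∧
      IsLeast {c | c ∈ Set.Icc 1 lam⁻¹ ∧ ES P' (c * lam) Z ≤ VaR P' lam Z} c := fun h =>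
    exists_isLeast_crossing (e := fun c => ES P' (c * lam) Z) hle hcont
      (by simpa using VaR_le_ES hZint h0 h1)
      (by simpa [inv_mul_cancel₀ h0.ne', ES_one hZint.aemeasurable] using h)
  have hmarg : ∀ i, 0 < S i i → pelve P lam (comp X i) = pelve P' lam Z := fun i hi =>
    pelve_comp_eq hE hV (Real.sqrt_pos.2 hi)
  refine ⟨hmarg, fun ω hω hsum hpos => aPelve_eq hω hsum fun i hi => hmarg i (hpos i hi),
    fun ⟨i, hi⟩ => wcPelve_eq hσ hE hV ⟨i, Real.sqrt_pos.2 hi⟩,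
    fun ⟨i, hi⟩ g hg => sysPelve_eq hσ hE hV hg.monotone fun y hy => ⟨i, hg ?_⟩,
    fun ω hω ⟨i, hωi, hi⟩ => ⟨fun h => ?_, fun h => ?_⟩, sysPelve_le hσ hE hV hmono,
    fun h ⟨γ, hγ, hanti⟩ => ?_⟩
  · have := mul_lt_mul_of_pos_left hy (Real.sqrt_pos.2 hi)
    linarith
  · obtain ⟨c, hc, hleast⟩ := hcross h
    rw [pelve, extInf_eq_of_isLeast hleast, msePelve]
    congr 1
    -- The minimum is zero, so minimizers are exactly the zeros of `e - v`.
    have hiff := isMinOn_mseObjective_iff hω ⟨i, hωi, Real.sqrt_pos.2 hi⟩ hE hV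
    refine IsLeast.csInf_eq ⟨⟨hleast.1.1, (hiff _ hleast.1.1).2 fun d _ => ?_⟩, fun d hd => ?_⟩
    · simp [hc]
    · have := (hiff _ hd.1).1 hd.2 c hleast.1.1
      rw [hc, sub_self, abs_zero, abs_nonpos_iff, sub_eq_zero] at this
      exact hleast.2 ⟨hd.1, this.le⟩
  · rw [← ES_one hZint.aemeasurable] at h
    have hge : ∀ d ∈ Set.Icc 1 lam⁻¹, ES P' 1 Z ≤ ES P' (d * lam) Z := fun d hd =>
      antitoneOn_ES hZint (hmem d hd) ⟨one_pos, le_rfl⟩ (hmem d hd).2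
    have hlast : lam⁻¹ ∈ Set.Icc 1 lam⁻¹ := Set.right_mem_Icc.2 hle
    have habs : ∀ d ∈ Set.Icc 1 lam⁻¹, |ES P' (d * lam) Z - VaR P' lam Z| =
        ES P' (d * lam) Z - VaR P' lam Z := fun d hd =>
      abs_of_pos (sub_pos.2 (h.trans_le (hge d hd)))
    have hiff := isMinOn_mseObjective_iff hω ⟨i, hωi, Real.sqrt_pos.2 hi⟩ hE hV
    refine IsLeast.csInf_eq ⟨⟨hlast, (hiff _ hlast).2 fun d hd => ?_⟩, fun d hd => ?_⟩
    · rw [habs _ hlast, habs _ hd, inv_mul_cancel₀ h0.ne']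
      exact sub_le_sub_right (hge d hd) _
    · by_contra! hlt
      have hmin := (hiff _ hd.1).1 hd.2 _ hlast
      rw [habs _ hlast, habs _ hd.1, inv_mul_cancel₀ h0.ne', sub_le_sub_iff_right] at hmin
      have hd1 : d * lam < 1 := by
        have := mul_lt_mul_of_pos_right hlt h0
        rwa [inv_mul_cancel₀ h0.ne'] at this
      have hd0 := (hmem d hd.1).1
      have hV' : VaR P' (d * lam) Z ≤ VaR P' lam Z :=
        antitoneOn_VaR hZint.aemeasurable hlam ⟨hd0, hd1⟩ (le_mul_of_one_le_left h0.le hd.1.1)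
      exact absurd ((ES_one_le_VaR hZint hd0 hd1 hmin).trans hV') h.not_ge
  · obtain ⟨c, hc, hleast⟩ := hcross h
    have hc1 : 1 < c := by
      refine hleast.1.1.1.lt_of_ne fun hc1 => ?_
      rw [← hc1, one_mul] at hc
      -- `γ < λ` leaves room below `λ` to contradict strict decrease.
      have hs : γ < (γ + lam) / 2 ∧ (γ + lam) / 2 < lam := by
        constructor <;> linarith [hγ.2]
      exact absurd (ES_le_of_ES_le_VaR hZint (hγ.1.trans_lt hs.1) hs.2.le h1 hc.le)
        (hanti ⟨hs.1, hs.2.le.trans h1.le⟩ ⟨hγ.2, h1.le⟩ hs.2).not_ge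
    constructor
    · intro heq
      by_contra! hneg
      refine absurd heq (ne_of_lt ?_)
      rw [pelve, extInf_eq_of_isLeast hleast]
      exact sysPelve_max_lt hσ hE hV hcont hc1 hleast.1.1.2 hc fun i hi =>
        hneg i (Real.sqrt_pos.1 hi)
    · rintro ⟨i, hi, hmi⟩
      refine sysPelve_eq hσ hE hV hmono fun y hy => ⟨i, ?_⟩
      have := mul_lt_mul_of_pos_left hy (Real.sqrt_pos.2 hi)
      have hv : 0 ≤ -m i + Real.sqrt (S i i) * VaR P' lam Z := by linarith
      dsimp only
      rw [max_eq_right hv]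
      exact lt_max_of_lt_right (by linarith)
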